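/- Let $n$ discrete-time linear control systems $\Sigma_j$: $x^{(j)}_{k+1}=A_jx^{(j)}_k+B_ju^{(j)}_k$, $j=1,\dots,n$, be given, with state spaces $X_j=\mathbb R^{d_j}$ and nonempty control value sets $U_j\subset\mathbb R^{m_j}$, and let $\Sigma$ be their direct product, with state space $X=X_1\times\cdots\times X_n$, control value set $U=U_1\times\cdots\times U_n$, and right-hand side $f(x,u)=(A_1x_1+B_1u_1,\dots,A_nx_n+B_nu_n)$. For $x\in X$ and $\omega\in U^{\mathbb Z_+}$ let $\varphi(k,x,\omega)$ be the state at time $k$ of the trajectory of $\Sigma$ starting in $x$ with control sequence $\omega$. Let $Q\subset X$ be compact with nonempty interior and such that for every $x\in Q$ there is $u\in U$ with $f(x,u)\in\operatorname{int}Q$. For an integer $\tau>0$, a set $\mathcal S\subset U^{\mathbb Z_+}$ is called $(\tau,Q)$-spanning if for every $x\in Q$ there is $\omega\in\mathcal S$ with $\varphi(k,x,\omega)\in\operatorname{int}Q$ for $k=1,\dots,\tau$; a set $\mathcal S_i\subset U_i^{\mathbb Z_+}$ is called $(\tau,Q)^{(i)}$-spanning if the set of all $\omega\in U^{\mathbb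 Z_+}$ whose $i$-th component lies in $\mathcal S_i$ is $(\tau,Q)$-spanning. Let $r_{\rm inv}(\tau,Q)$ and $r^{(i)}_{\rm inv}(\tau,Q)$ be the minimal cardinalities of such sets, and put $$h_{\rm inv}(Q)=\lim_{\tau\to\infty}\frac1\tau\log_2 r_{\rm inv}(\tau,Q),\qquad h^{(i)}_{\rm inv}(Q)=\lim_{\tau\to\infty}\frac1\tau\log_2 r^{(i)}_{\rm inv}(\tau,Q).$$ Assume that there is a compact set $K\subset\operatorname{int}Q$ such that for every $x\in Q$ there is $u\in U$ with $f(x,u)\in\operatorname{int}K$. Fix $i\in\{1,\dots,n\}$ and assume that for each $j\neq i$ the pair $(A_j,B_j)$ is controllable (the matrix $[B_j,A_jB_j,\dots,A_j^{d_j-1}B_j]$ has rank $d_j$) and $U_j\subset\overline{\operatorname{int}U_j}$ (for example, $U_j=\mathbb R^{m_j}$, or $U_j$ convex with nonempty interior). Then the numbers $r^{(i)}_{\rm inv}(\tau,Q)$, $\tau>0$, are finite, the limit defining $h^{(i)}_{\rm inv}(Q)$ exists, and $$h^{(i)}_{\rm inv}(Q)=\sum_{\lambda\in\sigma(A_i)}\max\{0,\,n_\lambda\log_2|\lambda|\},$$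 where $\sigma(A_i)\subset\mathbb C$ is the set of distinct complex eigenvalues of $A_i$, $n_\lambda$ is the algebraic multiplicity of $\lambda$, and an eigenvalue $\lambda=0$ contributes $0$. In particular, if all pairs $(A_j,B_j)$ are controllable and, in case $n\ge2$, $U_j\subset\overline{\operatorname{int}U_j}$ for all $j$, then the numbers $r_{\rm inv}(\tau,Q)$ are finite, the limit defining $h_{\rm inv}(Q)$ exists, and $$\sum_{i=1}^n h^{(i)}_{\rm inv}(Q)=h_{\rm inv}(Q).$$ -/

import Mathlib

open Filter Topology

namespace NetEntropy

noncomputable section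

/-! ### Control systems and invariance entropy

A discrete-time control system is given by its right-hand side `f : X → U → X`;
the admissible control sequences are all functions `ℕ → U`. -/

/-- The transition map: `transition f k x ω = (f_{ω (k-1)} ∘ ⋯ ∘ f_{ω 0}) x`. -/
def transition {X U : Type*} (f : X → U → X) : ℕ → X → (ℕ → U) → X
  | 0, x, _ => x
  | k + 1, x, ω => f (transition f k x ω) (ω k)

/-- `Q` is (strongly) controlled invariant: a compact set with nonempty interior such that
every point of `Q` can be steered into the interior of `Q` in one step. -/
structure IsControlledInvariant {X U : Type*} [TopologicalSpace X] (f : X → U → X)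
    (Q : Set X) : Prop where
  isCompact : IsCompact Q
  interior_nonempty : (interior Q).Nonempty
  steer : ∀ x ∈ Q, ∃ u : U, f x u ∈ interior Q

/-- `S` is `(τ, Q)`-spanning. -/
def IsSpanning {X U : Type*} [TopologicalSpace X] (f : X → U → X) (τ : ℕ) (Q : Set X)
    (S : Set (ℕ → U)) : Prop :=
  ∀ x ∈ Q, ∃ ω ∈ S, ∀ k : ℕ, 1 ≤ k → k ≤ τ → transition f k x ω ∈ interior Q

/-- The minimal cardinality of a `(τ, Q)`-spanning set (`⊤` if there is no finite one). -/
def rInv {X U : Type*} [TopologicalSpace X] (f : X → U → X) (τ : ℕ) (Q : Set X) : ℕ∞ :=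
  ⨅ (S : Set (ℕ → U)) (_ : IsSpanning f τ Q S), S.encard

/-- The numbers `(1/τ) log₂ r_inv(τ, Q)`. -/
def entropySeq {X U : Type*} [TopologicalSpace X] (f : X → U → X) (Q : Set X) (τ : ℕ) : ℝ :=
  1 / (τ : ℝ) * Real.logb 2 ((rInv f τ Q).toNat : ℝ)

/-- The invariance entropy `h_inv(Q)`, the limit of `entropySeq f Q`. -/
def hInv {X U : Type*} [TopologicalSpace X] (f : X → U → X) (Q : Set X) : ℝ :=
  limUnder atTop (entropySeq f Q)

/-! ### Networks of subsystems -/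

/-- The overall system: the direct product of the subsystems `f j`. -/
def prodSystem {ι : Type*} {X U : ι → Type*} (f : ∀ j, X j → U j → X j) :
    (∀ j, X j) → (∀ j, U j) → ∀ j, X j :=
  fun x u j => f j (x j) (u j)

/-- A set `S` of control sequences of the `i`-th subsystem is `(τ, Q)^{(i)}`-spanning if the set
of all control sequences of the overall system whose `i`-th component is in `S` is
`(τ, Q)`-spanning for the overall system. -/
def IsSubSpanning {ι : Type*} {X U : ι → Type*} [∀ j, TopologicalSpace (X j)]
    (f : ∀ j, X j → U j → X j) (i : ι) (τ : ℕ) (Q : Set (∀ j, X j))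
    (S : Set (ℕ → U i)) : Prop :=
  IsSpanning (prodSystem f) τ Q {ω : ℕ → ∀ j, U j | (fun k => ω k i) ∈ S}

/-- The minimal cardinality of a `(τ, Q)^{(i)}`-spanning set (`⊤` if there is no finite one). -/
def rSub {ι : Type*} {X U : ι → Type*} [∀ j, TopologicalSpace (X j)]
    (f : ∀ j, X j → U j → X j) (i : ι) (τ : ℕ) (Q : Set (∀ j, X j)) : ℕ∞ :=
  ⨅ (S : Set (ℕ → U i)) (_ : IsSubSpanning f i τ Q S), S.encard

/-- The numbers `(1/τ) log₂ r_inv^{(i)}(τ, Q)`. -/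
def subEntropySeq {ι : Type*} {X U : ι → Type*} [∀ j, TopologicalSpace (X j)]
    (f : ∀ j, X j → U j → X j) (i : ι) (Q : Set (∀ j, X j)) (τ : ℕ) : ℝ :=
  1 / (τ : ℝ) * Real.logb 2 ((rSub f i τ Q).toNat : ℝ)

/-- The `i`-th subsystem invariance entropy of `Q`, the limit of `subEntropySeq f i Q`. -/
def hSub {ι : Type*} {X U : ι → Type*} [∀ j, TopologicalSpace (X j)]
    (f : ∀ j, X j → U j → X j) (i : ι) (Q : Set (∀ j, X j)) : ℝ :=
  limUnder atTop (subEntropySeq f i Q)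

/-! ### Linear systems -/

/-- The linear system `x ↦ A x + B u` on `ℝ^d` with control value set `U ⊆ ℝ^m`. -/
def linSystem {d m : ℕ} (A : Matrix (Fin d) (Fin d) ℝ) (B : Matrix (Fin d) (Fin m) ℝ)
    (U : Set (Fin m → ℝ)) : (Fin d → ℝ) → U → (Fin d → ℝ) :=
  fun x u => A.mulVec x + B.mulVec (u : Fin m → ℝ)

/-- The pair `(A, B)` is controllable: the matrix `[B, A B, …, A^(d-1) B]` has rank `d`. -/
def IsControllable {d m : ℕ} (A : Matrix (Fin d) (Fin d) ℝ) (B : Matrix (Fin d) (Fin m) ℝ) :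
    Prop :=
  (Matrix.of fun (r : Fin d) (c : Fin d × Fin m) => (A ^ (c.1 : ℕ) * B) r c.2).rank = d

/-- `∑ max {0, n_z log₂ |z|}` over the distinct complex eigenvalues `z` of the real matrix `A`,
where `n_z` is the algebraic multiplicity of `z`. (A zero eigenvalue contributes `0`.) -/
def unstableSum {d : ℕ} (A : Matrix (Fin d) (Fin d) ℝ) : ℝ :=
  ∑ z ∈ (A.map (algebraMap ℝ ℂ)).charpoly.roots.toFinset,
    max 0 (((A.map (algebraMap ℝ ℂ)).charpoly.rootMultiplicity z : ℝ) * Real.logb 2 ‖z‖)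

end

end NetEntropy

/-!
Observe the controls of the components in a finite set `I` of subsystems; `I = {i}` and `I = univ`
are the two cases of the theorem, and the growth rate is the sum of `unstableSum (A j)` over `I`.

Lower bound: two trajectories that stay in `Q` under the same observed controls differ at time `τ`
by `A j ^ τ` applied to the difference of their initial values, for each `j ∈ I`. So the initial
values sharing one observed control have volume `O(∏ |λ|^(-τ))` over the unstable eigenvalues of
the `A j`, and `Q` has positive volume.

Upper bound: a volume comparison covers `Q` by about `∏ |λ|^τ` sets of points whose difference
stays small under `A j, …, A j ^ τ` for `j ∈ I`. Each set is handled by the controls of its centre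
in the components in `I`, with a uniform margin obtained from the compactness of `Q`. In the other
components a deadbeat correction, which exists by controllability, merges the trajectory with that
of the centre; it is admissible because `U j ⊆ closure (interior (U j))` allows the controls of the
centre to be kept at a uniform distance from the complement of `U j`.

In both bounds the components outside `I` enter with `1` in place of `A j`: only the distance of
the initial values is controlled there.
-/

open Polynomial Matrix MeasureTheory
open scoped Matrix.Norms.Operator ComplexConjugate

namespace NetEntropy

section Spectral

theorem eq_or_eq_conj_of_irreducible {f : ℝ[X]} (hf : Irreducible f) {z w : ℂ}
    (hz : aeval z f = 0) (hw : aeval w f = 0) : w = z ∨ w = conj z := by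
  have hconj : IsConjRoot ℝ w z := by
    rw [IsConjRoot, ← minpoly.eq_of_irreducible hf hw, minpoly.eq_of_irreducible hf hz]
  have : Normal ℝ ℂ :=
    normal_iff.2 fun x => ⟨Algebra.IsIntegral.isIntegral x, IsAlgClosed.splits _⟩
  obtain ⟨σ, rfl⟩ := hconj.exists_algEquiv
  rcases Complex.real_algHom_eq_id_or_conj (σ : ℂ →ₐ[ℝ] ℂ) with h | h
  · exact .inl (DFunLike.congr_fun h z)
  · exact .inr (DFunLike.congr_fun h z)

theorem exists_mul_eq_of_conj_invariant {s : Set ℂ} (hs : ∀ z ∈ s, conj z ∈ s) {χ : ℝ[X]}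
    (hχ : χ ≠ 0) :
    ∃ p q : ℝ[X], p * q = χ ∧ (∀ z : ℂ, aeval z p = 0 → z ∈ s) ∧
      ∀ z : ℂ, aeval z q = 0 → z ∉ s := by
  induction χ using WfDvdMonoid.induction_on_irreducible with
  | zero => exact absurd rfl hχ
  | unit u hu =>
    refine ⟨1, u, one_mul u, by simp, fun z hz => ?_⟩
    exact absurd hz (hu.map (aeval z)).ne_zero
  | mul g f hg hf ih =>
    obtain ⟨p, q, rfl, hp, hq⟩ := ih hg
    by_cases hfs : ∃ z ∈ s, aeval z f = 0
    · obtain ⟨z, hz, hfz⟩ := hfs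
      refine ⟨f * p, q, mul_assoc f p q, fun w hw => ?_, hq⟩
      rw [map_mul, mul_eq_zero] at hw
      rcases hw with hfw | hpw
      · rcases eq_or_eq_conj_of_irreducible hf hfz hfw with rfl | rfl
        exacts [hz, hs z hz]
      · exact hp w hpw
    · refine ⟨p, f * q, mul_left_comm p f q, hp, fun w hw => ?_⟩
      rw [map_mul, mul_eq_zero] at hw
      rcases hw with hfw | hqw
      exacts [fun hws => hfs ⟨w, hws, hfw⟩, hq w hqw]

variable {n : Type*} [Fintype n] [DecidableEq n]

theorem det_aeval_eq_prod_roots_charpoly {𝕜 : Type*} [Field 𝕜] [IsAlgClosed 𝕜]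
    (M : Matrix n n 𝕜) (q : 𝕜[X]) :
    (aeval M q).det = (M.charpoly.roots.map fun z => q.eval z).prod := by
  have hsplits := IsAlgClosed.splits M.charpoly
  have hcard : Multiset.card M.charpoly.roots = Fintype.card n := by
    rw [← hsplits.natDegree_eq_card_roots, charpoly_natDegree_eq_dim]
  induction IsAlgClosed.splits q using Submonoid.closure_induction with
  | one => simp
  | mul p q _ _ hp hq => simp only [map_mul, det_mul, hp, hq, eval_mul, Multiset.prod_map_mul]
  | mem q hq =>
    rcases hq with ⟨c, rfl⟩ | ⟨c, rfl⟩
    · simp [hcard, algebraMap_eq_diagonal, det_diagonal]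
    · have haeval : aeval M (X + C c) = -(scalar n (-c) - M) := by
        rw [map_neg, map_add, aeval_X, aeval_C, neg_sub, sub_neg_eq_add]
        rfl
      have hneg : (fun z => (X + C c).eval z) = fun z => (-1 : 𝕜) * (-c - z) := by
        funext z
        simp
      rw [haeval, det_neg, ← eval_charpoly,
        hsplits.eval_eq_prod_roots_of_monic M.charpoly_monic, hneg, Multiset.prod_map_mul,
        Multiset.map_const', Multiset.prod_replicate, hcard]

theorem map_aeval_ofReal (A : Matrix n n ℝ) (q : ℝ[X]) :
    (aeval A q).map (algebraMap ℝ ℂ) = aeval (A.map (algebraMap ℝ ℂ)) (q.map (algebraMap ℝ ℂ)) := by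
  rw [aeval_map_algebraMap]
  exact (aeval_algHom_apply ((Algebra.ofId ℝ ℂ).mapMatrix (m := n)) A q).symm

theorem abs_det_aeval (A : Matrix n n ℝ) (q : ℝ[X]) :
    |(aeval A q).det|
      = ((A.map (algebraMap ℝ ℂ)).charpoly.roots.map fun z => ‖aeval z q‖).prod := by
  have hdet : algebraMap ℝ ℂ (aeval A q).det
      = ((A.map (algebraMap ℝ ℂ)).charpoly.roots.map fun z => aeval z q).prod := by
    rw [RingHom.map_det, RingHom.mapMatrix_apply, map_aeval_ofReal,
      det_aeval_eq_prod_roots_charpoly]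
    simp only [eval_map_algebraMap]
  have hnorm := congrArg norm hdet
  rw [norm_algebraMap', Real.norm_eq_abs] at hnorm
  rw [hnorm]
  simpa [Multiset.map_map] using
    map_multiset_prod (normHom : ℂ →*₀ ℝ)
      ((A.map (algebraMap ℝ ℂ)).charpoly.roots.map fun z => aeval z q)

theorem exists_norm_pow_le_of_spectralRadius_lt {𝔸 : Type*} [NormedRing 𝔸] [NormedAlgebra ℂ 𝔸]
    [CompleteSpace 𝔸] {a : 𝔸} {ρ : ℝ} (ha : spectralRadius ℂ a < ENNReal.ofReal ρ) :
    ∃ C : ℝ, 0 < C ∧ ∀ k : ℕ, ‖a ^ k‖ ≤ C * ρ ^ k := by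
  have hρ : 0 < ρ := ENNReal.ofReal_pos.1 (bot_le.trans_lt ha)
  have hO : (fun k : ℕ => a ^ k) =O[atTop] fun k => ρ ^ k := by
    refine .of_bound 1 ?_
    filter_upwards [eventually_ne_atTop 0,
      (spectrum.pow_norm_pow_one_div_tendsto_nhds_spectralRadius a).eventually_lt_const ha]
      with k hk hlt
    rw [one_div] at hlt
    rw [one_mul, Real.norm_of_nonneg (by positivity)]
    calc ‖a ^ k‖ = (‖a ^ k‖ ^ (k : ℝ)⁻¹) ^ k :=
          (Real.rpow_inv_natCast_pow (norm_nonneg _) hk).symm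
      _ ≤ ρ ^ k :=
          pow_le_pow_left₀ (by positivity) ((ENNReal.ofReal_lt_ofReal_iff hρ).1 hlt).le k
  obtain ⟨C, hC, hbound⟩ := Asymptotics.bound_of_isBigO_nat_atTop hO
  refine ⟨C, hC, fun k => ?_⟩
  simpa [abs_of_pos hρ] using hbound (pow_ne_zero k hρ.ne')

theorem exists_norm_aeval_pow_le {A : Matrix n n ℝ} {q : ℝ[X]} {ρ : ℝ} (hρ : 0 < ρ)
    (hq : ∀ z ∈ spectrum ℂ (A.map (algebraMap ℝ ℂ)), ‖aeval z q‖ < ρ) :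
    ∃ C : ℝ, 0 < C ∧ ∀ k : ℕ, ‖aeval A q ^ k‖ ≤ C * ρ ^ k := by
  have hrad : spectralRadius ℂ ((aeval A q).map (algebraMap ℝ ℂ)) < ENNReal.ofReal ρ := by
    rcases subsingleton_or_nontrivial (Matrix n n ℂ) with h | h
    · simpa [spectralRadius, spectrum.of_subsingleton] using hρ
    · refine spectrum.spectralRadius_lt_of_forall_lt _ fun z hz => ?_
      rw [map_aeval_ofReal, spectrum.map_polynomial_aeval] at hz
      obtain ⟨w, hw, rfl⟩ := hz
      rw [← NNReal.coe_lt_coe]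
      simpa [eval_map_algebraMap, hρ.le] using hq w hw
  obtain ⟨C, hC, hbound⟩ := exists_norm_pow_le_of_spectralRadius_lt hrad
  refine ⟨C, hC, fun k => ?_⟩
  have hnorm : ∀ M : Matrix n n ℝ, ‖M.map (algebraMap ℝ ℂ)‖ = ‖M‖ := fun M => by
    simp [linfty_opNorm_def]
  rw [← hnorm, ← RingHom.mapMatrix_apply, map_pow]
  exact hbound k

section CommRing

variable {R : Type*} [CommRing R] {a p r : R}

theorem mul_add_one_sub_pow (hp : IsIdempotentElem p) (k : ℕ) :
    (a * p + (1 - p)) ^ k = a ^ k * p + (1 - p) := by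
  induction k with
  | zero => simp
  | succ k ih =>
    rw [pow_succ, ih]
    linear_combination (a ^ k * a - a ^ k - a + 1) * hp.eq

theorem mul_pow_mul_self (hp : IsIdempotentElem p) (k : ℕ) : (a * p) ^ k * p = a ^ k * p := by
  rw [mul_pow, mul_assoc, ← pow_succ, hp.pow_succ_eq]

theorem pow_eq_mul_mul_add_one_sub_pow (hp : IsIdempotentElem p) (hr : r * a * p = p) (k l : ℕ) :
    a ^ k = ((a * (1 - p)) ^ k * (1 - p) + (r * p) ^ l * p) * (a * p + (1 - p)) ^ (k + l) := by
  have hrl : (r * a) ^ l * p = p := by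
    induction l with
    | zero => simp
    | succ l ih => rw [pow_succ, mul_assoc, hr, ih]
  rw [mul_pow_mul_self hp.one_sub, mul_pow_mul_self hp, mul_add_one_sub_pow hp, pow_add]
  rw [mul_pow] at hrl
  linear_combination (-a ^ k) * hrl
    + (a ^ k * (a ^ k * a ^ l) - a ^ k + r ^ l - r ^ l * (a ^ k * a ^ l)) * hp.eq

end CommRing

/-- `p` and `r` split off the unstable part of `A`: modulo the characteristic polynomial, `p` is
the projection onto the generalized eigenspaces of the eigenvalues outside the closed unit disc,
along the others, and `r` inverts `X` on the range of `p`. -/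
structure IsUnstableSplitting (A : Matrix n n ℝ) (p r : ℝ[X]) : Prop where
  isIdempotentElem : IsIdempotentElem (AdjoinRoot.mk A.charpoly p)
  mul_root_mul : AdjoinRoot.mk A.charpoly (r * X * p) = AdjoinRoot.mk A.charpoly p
  aeval_eq_one : ∀ z ∈ spectrum ℂ (A.map (algebraMap ℝ ℂ)), 1 < ‖z‖ → aeval z p = 1
  aeval_eq_zero : ∀ z ∈ spectrum ℂ (A.map (algebraMap ℝ ℂ)), ‖z‖ ≤ 1 → aeval z p = 0

theorem aeval_eq_of_mk_charpoly_eq {A : Matrix n n ℝ} {f g : ℝ[X]}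
    (h : AdjoinRoot.mk A.charpoly f = AdjoinRoot.mk A.charpoly g) : aeval A f = aeval A g := by
  obtain ⟨q, hq⟩ := AdjoinRoot.mk_eq_mk.1 h
  rw [← sub_eq_zero, ← map_sub, hq, map_mul, aeval_self_charpoly, zero_mul]

theorem aeval_charpoly_eq_zero {A : Matrix n n ℝ} {z : ℂ}
    (hz : z ∈ spectrum ℂ (A.map (algebraMap ℝ ℂ))) : aeval z A.charpoly = 0 := by
  rw [← eval_map_algebraMap, ← charpoly_map]
  exact mem_spectrum_iff_isRoot_charpoly.1 hz

theorem exists_isUnstableSplitting (A : Matrix n n ℝ) :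
    ∃ p r : ℝ[X], IsUnstableSplitting A p r := by
  obtain ⟨f, g, hfg, hf, hg⟩ := exists_mul_eq_of_conj_invariant (s := {z | 1 < ‖z‖})
    (fun z hz => by simpa using hz) A.charpoly_monic.ne_zero
  have hcop : IsCoprime f g := by
    rw [isCoprime_iff_aeval_ne_zero_of_isAlgClosed ℝ ℂ]
    intro z
    by_contra! h
    exact hg z h.2 (hf z h.1)
  have hcopX : IsCoprime X f := by
    rw [isCoprime_iff_aeval_ne_zero_of_isAlgClosed ℝ ℂ]
    intro z
    by_contra! h
    have hz : 1 < ‖z‖ := hf z h.2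
    rw [show z = 0 by simpa using h.1, norm_zero] at hz
    exact absurd hz (by norm_num)
  obtain ⟨a, b, hab⟩ := hcop
  obtain ⟨r, s, hrs⟩ := hcopX
  have hroot : ∀ z ∈ spectrum ℂ (A.map (algebraMap ℝ ℂ)), aeval z f = 0 ∨ aeval z g = 0 :=
    fun z hz => by rw [← mul_eq_zero, ← map_mul, hfg, aeval_charpoly_eq_zero hz]
  refine ⟨b * g, r, ?_, ?_, fun z hz hz1 => ?_, fun z hz hz1 => ?_⟩
  · rw [IsIdempotentElem, ← map_mul, AdjoinRoot.mk_eq_mk]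
    exact ⟨-(a * b), by rw [← hfg]; linear_combination (b * g) * hab⟩
  · rw [AdjoinRoot.mk_eq_mk]
    exact ⟨-(s * b), by rw [← hfg]; linear_combination (b * g) * hrs⟩
  · have hfz : aeval z f = 0 := (hroot z hz).resolve_right fun h => hg z h hz1
    simpa [hfz] using congrArg (aeval z) hab
  · have hgz : aeval z g = 0 := (hroot z hz).resolve_left fun h => hz1.not_gt (hf z h)
    rw [map_mul, hgz, mul_zero]

namespace IsUnstableSplitting

variable {A : Matrix n n ℝ} {p r : ℝ[X]}

theorem aeval_pow (h : IsUnstableSplitting A p r) (k : ℕ) :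
    aeval A (X * p + (1 - p)) ^ k = aeval A p * A ^ k + aeval A (1 - p) := by
  have hmk := mul_add_one_sub_pow (a := AdjoinRoot.mk A.charpoly X) h.isIdempotentElem k
  have := aeval_eq_of_mk_charpoly_eq (A := A) (f := (X * p + (1 - p)) ^ k)
    (g := p * X ^ k + (1 - p)) (by simpa [mul_comm] using hmk)
  simpa using this

theorem pow_eq (h : IsUnstableSplitting A p r) (k l : ℕ) :
    A ^ k = (aeval A (X * (1 - p)) ^ k * aeval A (1 - p) + aeval A (r * p) ^ l * aeval A p)
      * aeval A (X * p + (1 - p)) ^ (k + l) := by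
  have hmk := pow_eq_mul_mul_add_one_sub_pow (a := AdjoinRoot.mk A.charpoly X)
    (r := AdjoinRoot.mk A.charpoly r) h.isIdempotentElem (by simpa using h.mul_root_mul) k l
  have := aeval_eq_of_mk_charpoly_eq (A := A) (f := X ^ k)
    (g := ((X * (1 - p)) ^ k * (1 - p) + (r * p) ^ l * p) * (X * p + (1 - p)) ^ (k + l))
    (by simpa using hmk)
  simpa using this

theorem abs_det (h : IsUnstableSplitting A p r) :
    |(aeval A (X * p + (1 - p))).det|
      = ((A.map (algebraMap ℝ ℂ)).charpoly.roots.map fun z => max 1 ‖z‖).prod := by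
  rw [abs_det_aeval]
  refine congrArg Multiset.prod (Multiset.map_congr rfl fun z hz => ?_)
  have hz' := mem_spectrum_of_isRoot_charpoly (isRoot_of_mem_roots hz)
  rcases lt_or_ge 1 ‖z‖ with h1 | h1
  · simp [h.aeval_eq_one z hz' h1, max_eq_right h1.le]
  · simp [h.aeval_eq_zero z hz' h1, max_eq_left h1]

theorem norm_aeval_stable_le (h : IsUnstableSplitting A p r) {z : ℂ}
    (hz : z ∈ spectrum ℂ (A.map (algebraMap ℝ ℂ))) : ‖aeval z (X * (1 - p))‖ ≤ 1 := by
  rcases lt_or_ge 1 ‖z‖ with h1 | h1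
  · simp [h.aeval_eq_one z hz h1]
  · simpa [h.aeval_eq_zero z hz h1] using h1

theorem norm_aeval_inverse_le (h : IsUnstableSplitting A p r) {z : ℂ}
    (hz : z ∈ spectrum ℂ (A.map (algebraMap ℝ ℂ))) : ‖aeval z (r * p)‖ ≤ 1 := by
  rcases lt_or_ge 1 ‖z‖ with h1 | h1
  · obtain ⟨q, hq⟩ := AdjoinRoot.mk_eq_mk.1 h.mul_root_mul
    have hmul := congrArg (aeval z) hq
    simp only [map_sub, map_mul, aeval_X, h.aeval_eq_one z hz h1, aeval_charpoly_eq_zero hz,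
      zero_mul, mul_one, sub_eq_zero] at hmul
    have hnorm := congrArg norm hmul
    rw [norm_mul, norm_one] at hnorm
    rw [map_mul, h.aeval_eq_one z hz h1, mul_one]
    nlinarith [norm_nonneg (aeval z r)]
  · simp [h.aeval_eq_zero z hz h1]

end IsUnstableSplitting

/-- `G` measures the uncertainty that has to be resolved to control `A`: its determinant is the
product of the moduli of the unstable eigenvalues of `A`, and up to subexponential factors `G ^ τ v`
is as large as the largest of `v, A v, …, A ^ τ v`. -/
structure IsExpansionGauge (A G : Matrix n n ℝ) : Prop where
  abs_det : |G.det| = ((A.map (algebraMap ℝ ℂ)).charpoly.roots.map fun z => max 1 ‖z‖).prod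
  norm_pow_mulVec_le : ∃ C : ℝ, 0 < C ∧ ∀ (τ : ℕ) (v : n → ℝ),
    ‖(G ^ τ) *ᵥ v‖ ≤ C * max ‖v‖ ‖(A ^ τ) *ᵥ v‖
  le_norm_pow_mulVec : ∀ ρ : ℝ, 1 < ρ → ∃ C : ℝ, 0 < C ∧ ∀ k τ : ℕ, k ≤ τ → ∀ v : n → ℝ,
    ‖(A ^ k) *ᵥ v‖ ≤ C * ρ ^ τ * ‖(G ^ τ) *ᵥ v‖

theorem IsUnstableSplitting.isExpansionGauge {A : Matrix n n ℝ} {p r : ℝ[X]}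
    (h : IsUnstableSplitting A p r) : IsExpansionGauge A (aeval A (X * p + (1 - p))) where
  abs_det := h.abs_det
  norm_pow_mulVec_le := by
    refine ⟨‖aeval A p‖ + ‖aeval A (1 - p)‖ + 1, by positivity, fun τ v => ?_⟩
    set M := max ‖v‖ ‖(A ^ τ) *ᵥ v‖
    have hM : 0 ≤ M := (norm_nonneg v).trans (le_max_left _ _)
    rw [h.aeval_pow, add_mulVec, ← mulVec_mulVec]
    calc ‖aeval A p *ᵥ (A ^ τ) *ᵥ v + aeval A (1 - p) *ᵥ v‖
        ≤ ‖aeval A p‖ * ‖(A ^ τ) *ᵥ v‖ + ‖aeval A (1 - p)‖ * ‖v‖ :=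
          norm_add_le_of_le (linfty_opNorm_mulVec _ _) (linfty_opNorm_mulVec _ _)
      _ ≤ ‖aeval A p‖ * M + ‖aeval A (1 - p)‖ * M := by
          gcongr
          exacts [le_max_right _ _, le_max_left _ _]
      _ ≤ (‖aeval A p‖ + ‖aeval A (1 - p)‖ + 1) * M := by linarith
  le_norm_pow_mulVec ρ hρ := by
    have hρ0 : 0 < ρ := one_pos.trans hρ
    obtain ⟨C₁, hC₁, hstable⟩ := exists_norm_aeval_pow_le (A := A) hρ0
      fun z hz => (h.norm_aeval_stable_le hz).trans_lt hρ
    obtain ⟨C₂, hC₂, hinverse⟩ := exists_norm_aeval_pow_le (A := A) hρ0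
      fun z hz => (h.norm_aeval_inverse_le hz).trans_lt hρ
    refine ⟨C₁ * ‖aeval A (1 - p)‖ + C₂ * ‖aeval A p‖ + 1, by positivity, fun k τ hk v => ?_⟩
    obtain ⟨l, rfl⟩ := Nat.exists_eq_add_of_le hk
    rw [h.pow_eq k l, ← mulVec_mulVec]
    refine (linfty_opNorm_mulVec _ _).trans (mul_le_mul_of_nonneg_right ?_ (norm_nonneg _))
    calc ‖aeval A (X * (1 - p)) ^ k * aeval A (1 - p) + aeval A (r * p) ^ l * aeval A p‖
        ≤ C₁ * ρ ^ k * ‖aeval A (1 - p)‖ + C₂ * ρ ^ l * ‖aeval A p‖ :=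
          norm_add_le_of_le (norm_mul_le_of_le (hstable k) le_rfl)
            (norm_mul_le_of_le (hinverse l) le_rfl)
      _ ≤ C₁ * ρ ^ (k + l) * ‖aeval A (1 - p)‖ + C₂ * ρ ^ (k + l) * ‖aeval A p‖ := by
          gcongr <;> first | exact hρ.le | omega
      _ ≤ (C₁ * ‖aeval A (1 - p)‖ + C₂ * ‖aeval A p‖ + 1) * ρ ^ (k + l) := by
          linarith [pow_pos hρ0 (k + l)]

theorem two_rpow_unstableSum {d : ℕ} (A : Matrix (Fin d) (Fin d) ℝ) :
    (2 : ℝ) ^ unstableSum A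
      = ((A.map (algebraMap ℝ ℂ)).charpoly.roots.map fun z => max 1 ‖z‖).prod := by
  rw [Finset.prod_multiset_map_count, unstableSum, Real.rpow_sum_of_pos two_pos]
  refine Finset.prod_congr rfl fun z _ => ?_
  rw [count_roots]
  rcases eq_or_ne z 0 with rfl | hz
  · simp
  have hz' : 0 < ‖z‖ := norm_pos_iff.2 hz
  rcases le_total ‖z‖ 1 with h | h
  · rw [max_eq_left h, one_pow, max_eq_left, Real.rpow_zero]
    exact mul_nonpos_of_nonneg_of_nonpos (by positivity)
      (Real.logb_nonpos one_lt_two hz'.le h)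
  · rw [max_eq_right h, max_eq_right, mul_comm, Real.rpow_mul zero_le_two,
      Real.rpow_logb two_pos (by norm_num) hz', Real.rpow_natCast]
    exact mul_nonneg (by positivity) (Real.logb_nonneg one_lt_two h)

end Spectral

section Volume

open Metric Module Measure

theorem exists_finset_separated_cover {X : Type*} [PseudoMetricSpace X] {A : Set X}
    (hA : TotallyBounded A) {r : ℝ} (hr : 0 < r) :
    ∃ t : Finset X, ↑t ⊆ A ∧ ((t : Set X).Pairwise fun y z => r < dist y z) ∧
      ∀ x ∈ A, ∃ y ∈ t, dist x y ≤ r := by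
  lift r to NNReal using hr.le
  obtain ⟨N, -, hNfin, hN⟩ :=
    exists_finite_isCover_of_totallyBounded (ε := r / 2) (by simpa using hr.ne') hA
  have hpack : packingNumber r A ≠ ⊤ := by
    refine ne_top_of_le_ne_top hNfin.encard_lt_top.ne ?_
    calc packingNumber r A = packingNumber (2 * (r / 2)) A := by rw [mul_div_cancel₀ r two_ne_zero]
      _ ≤ externalCoveringNumber (r / 2) A := packingNumber_two_mul_le_externalCoveringNumber _ _
      _ ≤ N.encard := hN.externalCoveringNumber_le_encard
  have hfin : (maximalSeparatedSet r A).Finite :=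
    Set.encard_ne_top_iff.1 ((encard_maximalSeparatedSet hpack).trans_ne hpack)
  refine ⟨hfin.toFinset, by simpa using maximalSeparatedSet_subset, fun y hy z hz hyz => ?_,
    fun x hx => ?_⟩
  · have hlt : r < edist y z :=
      isSeparated_maximalSeparatedSet (hfin.mem_toFinset.1 hy) (hfin.mem_toFinset.1 hz) hyz
    rwa [edist_nndist, ENNReal.coe_lt_coe, ← NNReal.coe_lt_coe, coe_nndist] at hlt
  · obtain ⟨y, hy, hxy⟩ := isCover_maximalSeparatedSet hpack hx
    have hle : edist x y ≤ r := hxy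
    rw [edist_le_coe, ← NNReal.coe_le_coe, coe_nndist] at hle
    exact ⟨y, hfin.mem_toFinset.2 hy, hle⟩

variable {E : Type*} [NormedAddCommGroup E] [MeasurableSpace E] [BorelSpace E]
  (μ : Measure E) [μ.IsAddHaarMeasure]

theorem card_mul_addHaar_ball_le {t : Finset E} {V : Set E} {r : ℝ}
    (hsep : (t : Set E).Pairwise fun y z => r < dist y z) (hV : ∀ y ∈ t, ball y (r / 2) ⊆ V) :
    t.card * μ (ball 0 (r / 2)) ≤ μ V := by
  have hdisj : (t : Set E).PairwiseDisjoint fun y => ball y (r / 2) := fun y hy z hz hyz =>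
    ball_disjoint_ball (by linarith [hsep hy hz hyz])
  calc (t.card : ENNReal) * μ (ball 0 (r / 2)) = ∑ y ∈ t, μ (ball y (r / 2)) := by
        simp only [addHaar_ball_center, Finset.sum_const, nsmul_eq_mul]
    _ = μ (⋃ y ∈ t, ball y (r / 2)) :=
        (measure_biUnion_finset hdisj fun _ _ => measurableSet_ball).symm
    _ ≤ μ V := measure_mono (Set.iUnion₂_subset hV)

variable [NormedSpace ℝ E] [FiniteDimensional ℝ E]

theorem ofReal_abs_det_mul_addHaar_le {β : Type*} {L : E →ₗ[ℝ] E} {W : Set E} {s : Finset β}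
    {V : β → Set E} (hW : W ⊆ ⋃ b ∈ s, V b) {D : ℝ}
    (hV : ∀ b ∈ s, ∀ x ∈ V b, ∀ x' ∈ V b, ‖L (x - x')‖ ≤ D) :
    ENNReal.ofReal |LinearMap.det L| * μ W ≤ s.card * μ (closedBall 0 D) := by
  have himage : ∀ b ∈ s, μ (L '' V b) ≤ μ (closedBall 0 D) := by
    intro b hb
    rcases (V b).eq_empty_or_nonempty with hempty | ⟨x₀, hx₀⟩
    · simp [hempty]
    · rw [← addHaar_closedBall_center μ (L x₀)]
      refine measure_mono ?_
      rintro _ ⟨x, hx, rfl⟩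
      rw [mem_closedBall, dist_eq_norm, ← map_sub]
      exact hV b hb x hx x₀ hx₀
  calc ENNReal.ofReal |LinearMap.det L| * μ W = μ (L '' W) := (addHaar_image_linearMap μ L W).symm
    _ ≤ μ (⋃ b ∈ s, L '' V b) := by
        refine measure_mono ?_
        simpa only [Set.image_iUnion₂] using Set.image_mono hW
    _ ≤ ∑ b ∈ s, μ (L '' V b) := measure_biUnion_finset_le s _
    _ ≤ s.card * μ (closedBall 0 D) := by
        rw [← nsmul_eq_mul]
        exact Finset.sum_le_card_nsmul s _ _ himage

theorem exists_finset_cover_card_mul_le {L : E →ₗ[ℝ] E} (hL : LinearMap.det L ≠ 0) {Q : Set E}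
    {R r ρ : ℝ} (hR : 0 ≤ R) (hQ : Q ⊆ closedBall 0 R) (hr : 0 < r) (hρ : 0 ≤ ρ)
    (hLρ : ∀ v, ‖L v‖ ≤ r → ‖v‖ ≤ ρ) :
    ∃ t : Finset E, ↑t ⊆ Q ∧ (∀ x ∈ Q, ∃ y ∈ t, ‖L (x - y)‖ ≤ r) ∧
      t.card * (r / 2) ^ finrank ℝ E ≤ |LinearMap.det L| * (R + ρ) ^ finrank ℝ E := by
  classical
  have hinj : Function.Injective L := (L.equivOfDetNeZero hL).injective
  have hsurj : Function.Surjective L := (L.equivOfDetNeZero hL).surjective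
  have htb : TotallyBounded (L '' Q) := by
    have := FiniteDimensional.proper_real E
    exact ((isCompact_closedBall 0 R).totallyBounded.subset hQ).image
      L.toContinuousLinearMap.uniformContinuous
  obtain ⟨s, hsQ, hsep, hcov⟩ := exists_finset_separated_cover htb hr
  obtain ⟨t, htQ, rfl⟩ := Finset.subset_set_image_iff.1 hsQ
  refine ⟨t, htQ, fun x hx => ?_, ?_⟩
  · obtain ⟨_, hy, hxy⟩ := hcov (L x) ⟨x, hx, rfl⟩
    obtain ⟨y, hyt, rfl⟩ := Finset.mem_image.1 hy
    exact ⟨y, hyt, by rwa [map_sub, ← dist_eq_norm]⟩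
  have hball : ∀ y ∈ t.image L, ball y (r / 2) ⊆ L '' closedBall 0 (R + ρ) := by
    intro y hy z hz
    obtain ⟨x, hx, rfl⟩ := Finset.mem_image.1 hy
    obtain ⟨w, rfl⟩ := hsurj z
    rw [mem_ball, dist_eq_norm, ← map_sub] at hz
    refine ⟨w, mem_closedBall_zero_iff.2 ?_, rfl⟩
    calc ‖w‖ = ‖x + (w - x)‖ := by rw [add_sub_cancel]
      _ ≤ R + ρ := norm_add_le_of_le (mem_closedBall_zero_iff.1 (hQ (htQ hx)))
          (hLρ _ (hz.le.trans (half_le_self hr.le)))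
  have hvol := card_mul_addHaar_ball_le addHaar hsep hball
  rw [Finset.card_image_of_injective t hinj, addHaar_image_linearMap,
    addHaar_closedBall _ _ (by positivity), addHaar_ball_of_pos _ _ (half_pos hr), ← mul_assoc,
    ← mul_assoc] at hvol
  have hle := (ENNReal.mul_le_mul_iff_left (measure_ball_pos _ _ one_pos).ne'
    measure_ball_lt_top.ne).1 hvol
  rwa [← ENNReal.ofReal_natCast, ← ENNReal.ofReal_mul (by positivity),
    ← ENNReal.ofReal_mul (by positivity), ENNReal.ofReal_le_ofReal_iff (by positivity)] at hle

variable {ι : Type*} [Fintype ι]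

theorem abs_det_piMap {n : ι → Type*} [∀ j, Finite (n j)]
    (f : ∀ j, (n j → ℝ) →ₗ[ℝ] (n j → ℝ)) :
    |LinearMap.det (LinearMap.piMap f)| = ∏ j, |LinearMap.det (f j)| := by
  have := fun j => Fintype.ofFinite (n j)
  -- Compute the volume of the image of a product of unit balls in two ways.
  set b : ∀ j, Set (n j → ℝ) := fun _ => ball 0 1
  have hb : ∀ j, volume (b j) ≠ 0 := fun j => (measure_ball_pos _ _ one_pos).ne'
  have himage := addHaar_image_linearMap volume (LinearMap.piMap f) (Set.univ.pi b)
  rw [LinearMap.coe_piMap, Set.piMap_image_univ_pi, volume_pi_pi, volume_pi_pi] at himage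
  simp only [addHaar_image_linearMap, Finset.prod_mul_distrib] at himage
  rw [ENNReal.mul_left_inj (Finset.prod_ne_zero_iff.2 fun j _ => hb j)
    (ENNReal.prod_ne_top fun j _ => measure_ball_lt_top.ne),
    ← ENNReal.ofReal_prod_of_nonneg fun j _ => abs_nonneg _,
    ENNReal.ofReal_eq_ofReal_iff (Finset.prod_nonneg fun j _ => abs_nonneg _) (abs_nonneg _)]
    at himage
  exact himage.symm

end Volume

section Counting

open Metric

variable {ι : Type*} [Fintype ι] {d : ι → ℕ} {A G : ∀ j, Matrix (Fin (d j)) (Fin (d j)) ℝ}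

/-- The block diagonal linear map on the product of the state spaces given by the `τ`-th powers of
the matrices `G j`; it is used with gauges `G j`. -/
def piPow (G : ∀ j, Matrix (Fin (d j)) (Fin (d j)) ℝ) (τ : ℕ) :
    (∀ j, Fin (d j) → ℝ) →ₗ[ℝ] ∀ j, Fin (d j) → ℝ :=
  LinearMap.piMap fun j => (G j ^ τ).mulVecLin

theorem abs_det_piPow (h : ∀ j, IsExpansionGauge (A j) (G j)) (τ : ℕ) :
    |LinearMap.det (piPow G τ)| = ((2 : ℝ) ^ ∑ j, unstableSum (A j)) ^ τ := by
  rw [piPow, abs_det_piMap, Real.rpow_sum_of_pos two_pos, ← Finset.prod_pow]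
  refine Finset.prod_congr rfl fun j _ => ?_
  rw [← toLin'_apply', LinearMap.det_toLin', det_pow, abs_pow, (h j).abs_det,
    two_rpow_unstableSum]

theorem exists_norm_piPow_le (h : ∀ j, IsExpansionGauge (A j) (G j)) :
    ∃ C : ℝ, 0 < C ∧ ∀ (τ : ℕ) (v : ∀ j, Fin (d j) → ℝ) (D : ℝ), ‖v‖ ≤ D →
      (∀ j, ‖(A j ^ τ) *ᵥ v j‖ ≤ D) → ‖piPow G τ v‖ ≤ C * D := by
  choose C hC hbound using fun j => (h j).norm_pow_mulVec_le
  have hsum : 0 ≤ ∑ j, C j := Finset.sum_nonneg fun j _ => (hC j).le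
  refine ⟨∑ j, C j + 1, by positivity, fun τ v D hv hAv => ?_⟩
  have hD : 0 ≤ D := (norm_nonneg v).trans hv
  refine (pi_norm_le_iff_of_nonneg (by positivity)).2 fun j => ?_
  calc ‖(G j ^ τ) *ᵥ v j‖ ≤ C j * max ‖v j‖ ‖(A j ^ τ) *ᵥ v j‖ := hbound j τ (v j)
    _ ≤ (∑ j, C j + 1) * D := by
        have hCj := Finset.single_le_sum (fun j _ => (hC j).le) (Finset.mem_univ j)
        exact mul_le_mul (by linarith) (max_le ((norm_le_pi_norm v j).trans hv) (hAv j))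
          (by positivity) (by positivity)

theorem exists_le_norm_piPow (h : ∀ j, IsExpansionGauge (A j) (G j)) {ρ : ℝ} (hρ : 1 < ρ) :
    ∃ C : ℝ, 0 < C ∧ ∀ (τ : ℕ) (v : ∀ j, Fin (d j) → ℝ), ∀ j, ∀ k ≤ τ,
      ‖(A j ^ k) *ᵥ v j‖ ≤ C * ρ ^ τ * ‖piPow G τ v‖ := by
  choose C hC hbound using fun j => (h j).le_norm_pow_mulVec ρ hρ
  have hsum : 0 ≤ ∑ j, C j := Finset.sum_nonneg fun j _ => (hC j).le
  refine ⟨∑ j, C j + 1, by positivity, fun τ v j k hk => ?_⟩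
  have hCj := Finset.single_le_sum (fun j _ => (hC j).le) (Finset.mem_univ j)
  calc ‖(A j ^ k) *ᵥ v j‖ ≤ C j * ρ ^ τ * ‖(G j ^ τ) *ᵥ v j‖ := hbound j k τ hk (v j)
    _ ≤ (∑ j, C j + 1) * ρ ^ τ * ‖piPow G τ v‖ := by
        gcongr
        · linarith
        · exact norm_le_pi_norm (piPow G τ v) j

theorem exists_mul_pow_le_card (A : ∀ j, Matrix (Fin (d j)) (Fin (d j)) ℝ)
    {W : Set (∀ j, Fin (d j) → ℝ)} (hW : 0 < volume.real W) (D : ℝ) :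
    ∃ c : ℝ, 0 < c ∧ ∀ (τ : ℕ) {β : Type*} (s : Finset β) (V : β → Set (∀ j, Fin (d j) → ℝ)),
      W ⊆ ⋃ b ∈ s, V b →
      (∀ b ∈ s, ∀ x ∈ V b, ∀ x' ∈ V b,
        ‖x - x'‖ ≤ D ∧ ∀ j, ‖(A j ^ τ) *ᵥ (x j - x' j)‖ ≤ D) →
      c * ((2 : ℝ) ^ ∑ j, unstableSum (A j)) ^ τ ≤ s.card := by
  choose p r hpr using fun j => exists_isUnstableSplitting (A j)
  have hG := fun j => (hpr j).isExpansionGauge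
  obtain ⟨C, -, hbound⟩ := exists_norm_piPow_le hG
  set κ := volume.real (closedBall (0 : ∀ j, Fin (d j) → ℝ) (C * D))
  refine ⟨volume.real W / (κ + 1), by positivity, fun τ β s V hWV hV => ?_⟩
  have hvol := ofReal_abs_det_mul_addHaar_le volume hWV fun b hb x hx x' hx' =>
    hbound τ (x - x') D (hV b hb x hx x' hx').1 (hV b hb x hx x' hx').2
  rw [abs_det_piPow hG] at hvol
  have hreal := ENNReal.toReal_mono
    (ENNReal.mul_ne_top (ENNReal.natCast_ne_top _) measure_closedBall_lt_top.ne) hvol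
  rw [ENNReal.toReal_mul, ENNReal.toReal_mul, ENNReal.toReal_ofReal (by positivity),
    ENNReal.toReal_natCast] at hreal
  rw [div_mul_eq_mul_div, div_le_iff₀ (by positivity), mul_comm]
  refine hreal.trans ?_
  gcongr
  exact (lt_add_one κ).le

theorem exists_rpow_natCast_le {η : ℝ} (hη : 0 < η) (N : ℕ) :
    ∃ ρ : ℝ, 1 < ρ ∧ ρ ^ N ≤ (2 : ℝ) ^ η := by
  refine ⟨(2 : ℝ) ^ (η / (N + 1)), Real.one_lt_rpow one_lt_two (by positivity), ?_⟩
  rw [← Real.rpow_mul_natCast zero_le_two]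
  refine Real.rpow_le_rpow_of_exponent_le one_le_two ?_
  rw [div_mul_eq_mul_div, div_le_iff₀ (by positivity)]
  linarith

theorem exists_finset_cover_card_le (A : ∀ j, Matrix (Fin (d j)) (Fin (d j)) ℝ)
    {Q : Set (∀ j, Fin (d j) → ℝ)} (hQ : Bornology.IsBounded Q) {δ η : ℝ} (hδ : 0 < δ)
    (hη : 0 < η) :
    ∃ C : ℝ, 0 < C ∧ ∀ τ : ℕ, ∃ t : Finset (∀ j, Fin (d j) → ℝ), ↑t ⊆ Q ∧
      (∀ x ∈ Q, ∃ y ∈ t, ∀ j, ∀ k ≤ τ, ‖(A j ^ k) *ᵥ (x j - y j)‖ ≤ δ) ∧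
      (t.card : ℝ) ≤ C * ((2 : ℝ) ^ (∑ j, unstableSum (A j) + η)) ^ τ := by
  choose p r hpr using fun j => exists_isUnstableSplitting (A j)
  set N := Module.finrank ℝ (∀ j, Fin (d j) → ℝ)
  set G := fun j => aeval (A j) (X * p j + (1 - p j))
  have hG : ∀ j, IsExpansionGauge (A j) (G j) := fun j => (hpr j).isExpansionGauge
  obtain ⟨ρ, hρ, hρη⟩ := exists_rpow_natCast_le hη N
  have : 0 < ρ := one_pos.trans hρ
  obtain ⟨C, hC, hbound⟩ := exists_le_norm_piPow hG hρ
  obtain ⟨R, hR, hQR⟩ := hQ.exists_pos_norm_le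
  refine ⟨((R + δ) / (δ / C / 2)) ^ N, by positivity, fun τ => ?_⟩
  have hr : 0 < δ / C / ρ ^ τ := by positivity
  have hclose : ∀ v, ‖piPow G τ v‖ ≤ δ / C / ρ ^ τ →
      ∀ j, ∀ k ≤ τ, ‖(A j ^ k) *ᵥ v j‖ ≤ δ := fun v hv j k hk => by
    calc ‖(A j ^ k) *ᵥ v j‖ ≤ C * ρ ^ τ * ‖piPow G τ v‖ := hbound τ v j k hk
      _ ≤ C * ρ ^ τ * (δ / C / ρ ^ τ) := by gcongr
      _ = δ := by field_simp
  have hdet : |LinearMap.det (piPow G τ)| = ((2 : ℝ) ^ ∑ j, unstableSum (A j)) ^ τ :=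
    abs_det_piPow hG τ
  have hdet0 : LinearMap.det (piPow G τ) ≠ 0 := abs_pos.1 (hdet ▸ by positivity)
  obtain ⟨t, htQ, hcov, hcard⟩ := exists_finset_cover_card_mul_le hdet0 hR.le
    (fun x hx => mem_closedBall_zero_iff.2 (hQR x hx)) hr hδ.le
    fun v hv => (pi_norm_le_iff_of_nonneg hδ.le).2 fun j => by simpa using hclose v hv j 0 τ.zero_le
  refine ⟨t, htQ, fun x hx => ?_, ?_⟩
  · obtain ⟨y, hy, hxy⟩ := hcov x hx
    exact ⟨y, hy, hclose _ hxy⟩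
  · rw [hdet, ← le_div_iff₀ (by positivity)] at hcard
    calc (t.card : ℝ)
        ≤ ((2 : ℝ) ^ ∑ j, unstableSum (A j)) ^ τ * (R + δ) ^ N / (δ / C / ρ ^ τ / 2) ^ N := hcard
      _ = ((R + δ) / (δ / C / 2)) ^ N * ((2 : ℝ) ^ (∑ j, unstableSum (A j)) * ρ ^ N) ^ τ := by
          simp only [mul_pow, div_pow, ← pow_mul, mul_comm N τ]
          field_simp
      _ ≤ ((R + δ) / (δ / C / 2)) ^ N * ((2 : ℝ) ^ (∑ j, unstableSum (A j) + η)) ^ τ := by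
          rw [Real.rpow_add two_pos]
          gcongr

end Counting

section Steering

theorem exists_forall_transition_mem {X U : Type*} {f : X → U → X} {Q : Set X} {p : X → U → Prop}
    (h : ∀ x ∈ Q, ∃ u, f x u ∈ Q ∧ p x u) {x : X} (hx : x ∈ Q) :
    ∃ ω : ℕ → U, ∀ k, transition f k x ω ∈ Q ∧ p (transition f k x ω) (ω k) := by
  have : Nonempty U := (h x hx).nonempty
  choose! F hF using h
  set y : ℕ → X := fun k => (fun z => f z (F z))^[k] x
  have hstep : ∀ k, y (k + 1) = f (y k) (F (y k)) := fun k => Function.iterate_succ_apply' _ _ _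
  have hy : ∀ k, y k ∈ Q := fun k => by
    induction k with
    | zero => exact hx
    | succ k ih => exact hstep k ▸ (hF _ ih).1
  have htransition : ∀ k, transition f k x (fun k => F (y k)) = y k := fun k => by
    induction k with
    | zero => rfl
    | succ k ih => rw [transition, ih, hstep]
  refine ⟨fun k => F (y k), fun k => ?_⟩
  rw [htransition]
  exact ⟨hy k, (hF _ (hy k)).2⟩

theorem transition_prodSystem {ι : Type*} {X U : ι → Type*} (f : ∀ j, X j → U j → X j) (k : ℕ)
    (x : ∀ j, X j) (ω : ℕ → ∀ j, U j) (j : ι) :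
    transition (prodSystem f) k x ω j = transition (f j) k (x j) (fun k => ω k j) := by
  induction k with
  | zero => rfl
  | succ k ih => simp only [transition, prodSystem, ih]

section LinStep

variable {n m : Type*} [Fintype n] [Fintype m] (A : Matrix n n ℝ) (B : Matrix n m ℝ)

/-- The linear system `x ↦ A x + B u` without control constraints. -/
def linStep : (n → ℝ) → (m → ℝ) → n → ℝ :=
  fun x u => A *ᵥ x + B *ᵥ u

theorem transition_linStep_add (k : ℕ) (x v : n → ℝ) (ω w : ℕ → m → ℝ) :
    transition (linStep A B) k (x + v) (ω + w)
      = transition (linStep A B) k x ω + transition (linStep A B) k v w := by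
  induction k with
  | zero => rfl
  | succ k ih =>
    simp only [transition, linStep, ih, Pi.add_apply, mulVec_add]
    abel

theorem transition_linStep [DecidableEq n] (k : ℕ) (x : n → ℝ) (ω : ℕ → m → ℝ) :
    transition (linStep A B) k x ω
      = (A ^ k) *ᵥ x + ∑ i ∈ Finset.range k, (A ^ i) *ᵥ B *ᵥ ω (k - 1 - i) := by
  induction k with
  | zero => simp [transition]
  | succ k ih =>
    rw [transition, linStep, ih, Finset.sum_range_succ', mulVec_add, mulVec_sum, mulVec_mulVec,
      ← pow_succ', add_assoc]
    simp only [mulVec_mulVec, ← Matrix.mul_assoc, ← pow_succ']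
    simp [Nat.sub_sub, add_comm]

end LinStep

section Controllable

variable {d m : ℕ} {A : Matrix (Fin d) (Fin d) ℝ} {B : Matrix (Fin d) (Fin m) ℝ}

theorem IsControllable.exists_linearMap (h : IsControllable A B) :
    ∃ R : (Fin d → ℝ) →ₗ[ℝ] Fin d × Fin m → ℝ,
      ∀ v, ∑ i : Fin d, (A ^ (i : ℕ)) *ᵥ B *ᵥ (fun a => R v (i, a)) = v := by
  set M : Matrix (Fin d) (Fin d × Fin m) ℝ := of fun r c => (A ^ (c.1 : ℕ) * B) r c.2
  have hrange : LinearMap.range M.mulVecLin = ⊤ := by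
    refine Submodule.eq_top_of_finrank_eq ?_
    rw [Module.finrank_fin_fun]
    exact h
  obtain ⟨R, hR⟩ := LinearMap.exists_rightInverse_of_surjective M.mulVecLin hrange
  refine ⟨R, fun v => ?_⟩
  have hMR : M *ᵥ R v = v := LinearMap.congr_fun hR v
  nth_rewrite 2 [← hMR]
  ext r
  simp only [Finset.sum_apply, mulVec_mulVec, mulVec, dotProduct, Fintype.sum_prod_type, M,
    of_apply]

theorem IsControllable.exists_deadbeat (h : IsControllable A B) :
    ∃ w : ℕ → (Fin d → ℝ) →ₗ[ℝ] Fin m → ℝ, (∀ k, d ≤ k → w k = 0) ∧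
      ∀ v, transition (linStep A B) d v (fun k => w k v) = 0 := by
  obtain ⟨R, hR⟩ := h.exists_linearMap
  refine ⟨fun k => if hk : k < d then
    -(LinearMap.funLeft ℝ ℝ fun a => (Fin.rev ⟨k, hk⟩, a)) ∘ₗ R ∘ₗ (A ^ d).mulVecLin else 0,
    fun k hk => by simp [hk.not_gt], fun v => ?_⟩
  rw [transition_linStep, Finset.sum_range, ← eq_neg_iff_add_eq_zero]
  nth_rewrite 1 [← hR ((A ^ d) *ᵥ v)]
  rw [← Finset.sum_neg_distrib]
  refine Finset.sum_congr rfl fun i _ => ?_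
  have hi : d - 1 - (i : ℕ) < d := by omega
  have hrev : Fin.rev ⟨d - 1 - (i : ℕ), hi⟩ = i := Fin.ext (by simp; omega)
  simp [hi, hrev, mulVec_neg, LinearMap.funLeft, Function.comp_def]

theorem continuous_transition_linStep {w : ℕ → (Fin d → ℝ) → Fin m → ℝ}
    (hw : ∀ k, Continuous (w k)) (k : ℕ) :
    Continuous fun v => transition (linStep A B) k v fun k => w k v := by
  induction k with
  | zero => exact continuous_id
  | succ k ih =>
    exact (continuous_const.matrix_mulVec ih).add (continuous_const.matrix_mulVec (hw k))

theorem IsControllable.eventually_exists_small (h : IsControllable A B) {η : ℝ} (hη : 0 < η) :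
    ∀ᶠ v in 𝓝 0, ∃ w : ℕ → Fin m → ℝ, ∀ k,
      ‖w k‖ < η ∧ ‖transition (linStep A B) k v w‖ < η := by
  obtain ⟨w, hw0, hwd⟩ := h.exists_deadbeat
  have hw : ∀ k, Continuous (w k) := fun k => (w k).continuous_of_finiteDimensional
  have hzero : ∀ k v, d ≤ k → transition (linStep A B) k v (fun k => w k v) = 0 := by
    intro k v hk
    induction k, hk using Nat.le_induction with
    | base => exact hwd v
    | succ k hk ih => simp [transition, linStep, ih, hw0 k hk]
  have hsmall : ∀ k, ∀ᶠ v in 𝓝 0,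
      ‖w k v‖ < η ∧ ‖transition (linStep A B) k v fun k => w k v‖ < η := fun k => by
    have hcontrol := (hw k).norm.tendsto 0
    have hstate := (continuous_transition_linStep (A := A) (B := B) hw k).norm.tendsto 0
    simp only [map_zero, transition_linStep, mulVec_zero, Finset.sum_const_zero, add_zero,
      norm_zero] at hcontrol hstate
    filter_upwards [hcontrol.eventually_lt_const hη, hstate.eventually_lt_const hη] with v h1 h2
    exact ⟨h1, by simpa only [transition_linStep] using h2⟩
  filter_upwards [(Finset.eventually_all (Finset.range d)).2 fun k _ => hsmall k] with v hv
  refine ⟨fun k => w k v, fun k => ?_⟩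
  rcases lt_or_ge k d with hk | hk
  · exact hv k (Finset.mem_range.2 hk)
  · simp [hzero k v hk, hw0 k hk, hη]

variable {U : Set (Fin m → ℝ)}

theorem transition_linSystem (k : ℕ) (x : Fin d → ℝ) (ω : ℕ → U) :
    transition (linSystem A B U) k x ω
      = transition (linStep A B) k x fun k => (ω k : Fin m → ℝ) := by
  induction k with
  | zero => rfl
  | succ k ih => simp only [transition, linSystem, linStep, ih]

theorem transition_linSystem_sub (k : ℕ) (x x' : Fin d → ℝ) (ω : ℕ → U) :
    transition (linSystem A B U) k x ω - transition (linSystem A B U) k x' ω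
      = (A ^ k) *ᵥ (x - x') := by
  simp only [transition_linSystem, transition_linStep, add_sub_add_right_eq_sub, mulVec_sub]

theorem IsControllable.eventually_exists_tracking (h : IsControllable A B) {η : ℝ}
    (hη : 0 < η) :
    ∀ᶠ v in 𝓝 0, ∀ (x : Fin d → ℝ) (ω : ℕ → U), (∀ k, Metric.ball ↑(ω k) η ⊆ U) →
      ∃ ω' : ℕ → U, ∀ k,
        ‖transition (linSystem A B U) k (x + v) ω' - transition (linSystem A B U) k x ω‖ < η := by
  filter_upwards [h.eventually_exists_small hη] with v ⟨w, hw⟩ x ω hω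
  refine ⟨fun k => ⟨ω k + w k, hω k (by simpa using (hw k).1)⟩, fun k => ?_⟩
  rw [transition_linSystem, transition_linSystem]
  change ‖transition (linStep A B) k (x + v) ((fun k => (ω k : Fin m → ℝ)) + w) - _‖ < η
  rw [transition_linStep_add, add_sub_cancel_left]
  exact (hw k).2

end Controllable

theorem exists_uniform_margin {X V Y : Type*} [TopologicalSpace X] [PseudoMetricSpace Y]
    {f : X → V → Y} (hf : ∀ v, Continuous (f · v)) {Q : Set X} (hQ : IsCompact Q) {O : Set Y}
    (hO : IsOpen O) {p : ℝ → V → Prop} (hp : ∀ v, Antitone (p · v))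
    (h : ∀ x ∈ Q, ∃ v, f x v ∈ O ∧ ∃ ε, 0 < ε ∧ p ε v) :
    ∃ η, 0 < η ∧ ∀ x ∈ Q, ∃ v, Metric.ball (f x v) η ⊆ O ∧ p η v := by
  refine hQ.induction_on
    (p := fun s => ∃ η, 0 < η ∧ ∀ x ∈ s, ∃ v, Metric.ball (f x v) η ⊆ O ∧ p η v)
    ⟨1, one_pos, by simp⟩ ?_ ?_ fun x hx => ?_
  · rintro s t hst ⟨η, hη, ht⟩
    exact ⟨η, hη, fun x hx => ht x (hst hx)⟩
  · rintro s t ⟨η₁, hη₁, hs⟩ ⟨η₂, hη₂, ht⟩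
    refine ⟨min η₁ η₂, lt_min hη₁ hη₂, ?_⟩
    rintro x (hx | hx)
    · obtain ⟨v, hball, hv⟩ := hs x hx
      exact ⟨v, (Metric.ball_subset_ball (min_le_left _ _)).trans hball,
        hp v (min_le_left _ _) hv⟩
    · obtain ⟨v, hball, hv⟩ := ht x hx
      exact ⟨v, (Metric.ball_subset_ball (min_le_right _ _)).trans hball,
        hp v (min_le_right _ _) hv⟩
  · obtain ⟨v, hvO, ε, hε, hv⟩ := h x hx
    obtain ⟨δ, hδ, hball⟩ := Metric.isOpen_iff.1 hO _ hvO
    have hnear : ∀ᶠ z in 𝓝 x, dist (f z v) (f x v) < δ / 2 :=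
      (hf v).continuousAt.eventually (Metric.ball_mem_nhds _ (half_pos hδ))
    refine ⟨_, mem_nhdsWithin_of_mem_nhds hnear, min ε (δ / 2), lt_min hε (half_pos hδ),
      fun z hz => ⟨v, (Metric.ball_subset_ball' ?_).trans hball, hp v (min_le_left _ _) hv⟩⟩
    linarith [min_le_right ε (δ / 2), Set.mem_ofPred_eq ▸ hz]

theorem exists_mem_pi_interior {ι : Type*} {X : ι → Type*} [∀ j, TopologicalSpace (X j)]
    {I : Finset ι} {S : ∀ j, Set (X j)} (hS : ∀ j ∉ I, S j ⊆ closure (interior (S j)))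
    {O : Set (∀ j, X j)} (hO : IsOpen O) {u : ∀ j, X j} (huO : u ∈ O) (hu : ∀ j, u j ∈ S j) :
    ∃ v ∈ O, ∀ j, v j ∈ S j ∧ (j ∉ I → v j ∈ interior (S j)) := by
  classical
  have hclosure : u ∈ closure (Set.univ.pi fun j => if j ∈ I then S j else interior (S j)) := by
    rw [closure_pi_set]
    intro j _
    by_cases hj : j ∈ I
    · simpa only [if_pos hj] using subset_closure (hu j)
    · simpa only [if_neg hj] using hS j hj (hu j)
  obtain ⟨v, hvO, hv⟩ := mem_closure_iff.1 hclosure O hO huO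
  refine ⟨v, hvO, fun j => ?_⟩
  have hvj := hv j trivial
  by_cases hj : j ∈ I
  · exact ⟨by simpa only [if_pos hj] using hvj, fun h => absurd hj h⟩
  · simp only [if_neg hj] at hvj
    exact ⟨interior_subset hvj, fun _ => hvj⟩

section Network

variable {ι : Type*} {d m : ι → ℕ}

/-- The network of linear systems `x ↦ A j x + B j u` with control value sets `U j`. -/
abbrev linNetwork (A : ∀ j, Matrix (Fin (d j)) (Fin (d j)) ℝ)
    (B : ∀ j, Matrix (Fin (d j)) (Fin (m j)) ℝ) (U : ∀ j, Set (Fin (m j) → ℝ)) :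
    (∀ j, Fin (d j) → ℝ) → (∀ j, U j) → ∀ j, Fin (d j) → ℝ :=
  prodSystem fun j => linSystem (A j) (B j) (U j)

variable {A : ∀ j, Matrix (Fin (d j)) (Fin (d j)) ℝ} {B : ∀ j, Matrix (Fin (d j)) (Fin (m j)) ℝ}
  {U : ∀ j, Set (Fin (m j) → ℝ)} {I : Finset ι}

theorem continuous_linNetwork_left (u : ∀ j, U j) : Continuous (linNetwork A B U · u) :=
  continuous_pi fun j => by
    simp only [linNetwork, prodSystem, linSystem]
    fun_prop

variable [Fintype ι]

theorem exists_steering_margin {Q O : Set (∀ j, Fin (d j) → ℝ)} (hQ : IsCompact Q)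
    (hO : IsOpen O) (hU : ∀ j ∉ I, U j ⊆ closure (interior (U j)))
    (hsteer : ∀ x ∈ Q, ∃ u, linNetwork A B U x u ∈ O) :
    ∃ η : ℝ, 0 < η ∧ ∀ x ∈ Q, ∃ u : ∀ j, U j,
      Metric.ball (linNetwork A B U x u) η ⊆ O ∧ ∀ j ∉ I, Metric.ball ↑(u j) η ⊆ U j := by
  refine exists_uniform_margin continuous_linNetwork_left hQ hO
    (fun u ε ε' hε h j hj => (Metric.ball_subset_ball hε).trans (h j hj)) fun x hx => ?_
  obtain ⟨u, hu⟩ := hsteer x hx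
  have hO' : IsOpen {v : ∀ j, Fin (m j) → ℝ | (fun j => A j *ᵥ x j + B j *ᵥ v j) ∈ O} :=
    hO.preimage (continuous_pi fun j =>
      continuous_const.add (continuous_const.matrix_mulVec (continuous_apply j)))
  obtain ⟨v, hvO, hv⟩ := exists_mem_pi_interior hU hO' (u := fun j => u j) hu fun j => (u j).2
  refine ⟨fun j => ⟨v j, (hv j).1⟩, hvO, ?_⟩
  have hball : ∀ᶠ ε in 𝓝[>] (0 : ℝ), ∀ j, j ∉ I → Metric.ball (v j) ε ⊆ U j := by
    refine eventually_all.2 fun j => ?_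
    by_cases hj : j ∈ I
    · exact .of_forall fun _ h => absurd hj h
    obtain ⟨ε₀, hε₀, h⟩ := Metric.mem_nhds_iff.1 (mem_interior_iff_mem_nhds.1 ((hv j).2 hj))
    filter_upwards [Ioo_mem_nhdsGT hε₀] with ε hε _
    exact (Metric.ball_subset_ball hε.2.le).trans h
  exact ((eventually_mem_nhdsWithin (s := Set.Ioi 0)).and hball).exists

theorem exists_network_tracking [DecidableEq ι] (hAB : ∀ j ∉ I, IsControllable (A j) (B j))
    {η : ℝ} (hη : 0 < η) :
    ∃ ρ : ℝ, 0 < ρ ∧ ∀ (x x' : ∀ j, Fin (d j) → ℝ) (ω : ℕ → ∀ j, U j) (τ : ℕ),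
      (∀ k, ∀ j ∉ I, Metric.ball ↑(ω k j) η ⊆ U j) →
      (∀ j, ∀ k ≤ τ, ‖(I.piecewise A 1 j ^ k) *ᵥ (x' j - x j)‖ ≤ ρ) →
      ∃ ω' : ℕ → ∀ j, U j, (∀ j ∈ I, ∀ k, ω' k j = ω k j) ∧ ∀ k ≤ τ,
        ‖transition (linNetwork A B U) k x' ω' - transition (linNetwork A B U) k x ω‖ < η := by
  have htrack : ∀ᶠ v in 𝓝 (0 : ∀ j, Fin (d j) → ℝ), ∀ j, j ∉ I → ∀ x (ω : ℕ → U j),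
      (∀ k, Metric.ball ↑(ω k) η ⊆ U j) → ∃ ω' : ℕ → U j, ∀ k,
        ‖transition (linSystem (A j) (B j) (U j)) k (x + v j) ω'
          - transition (linSystem (A j) (B j) (U j)) k x ω‖ < η := by
    refine eventually_all.2 fun j => ?_
    by_cases hj : j ∈ I
    · exact .of_forall fun _ h => absurd hj h
    · have hproj := (continuous_apply (A := fun j => Fin (d j) → ℝ) j).tendsto 0
      filter_upwards [hproj.eventually ((hAB j hj).eventually_exists_tracking hη)] with v hv _
      exact hv
  obtain ⟨ρ, hρ, hball⟩ := Metric.nhds_basis_closedBall.eventually_iff.1 htrack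
  refine ⟨min ρ (η / 2), by positivity, fun x x' ω τ hω hx => ?_⟩
  have hdist : x' - x ∈ Metric.closedBall 0 ρ :=
    mem_closedBall_zero_iff.2 ((pi_norm_le_iff_of_nonneg hρ.le).2 fun j => by
      simpa using (hx j 0 τ.zero_le).trans (min_le_left _ _))
  have hcomponent : ∀ j, ∃ ω' : ℕ → U j, (j ∈ I → ∀ k, ω' k = ω k j) ∧ ∀ k ≤ τ,
      ‖transition (linSystem (A j) (B j) (U j)) k (x' j) ω'
        - transition (linSystem (A j) (B j) (U j)) k (x j) fun k => ω k j‖ < η := fun j => by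
    by_cases hj : j ∈ I
    · refine ⟨fun k => ω k j, fun _ _ => rfl, fun k hk => ?_⟩
      have hxj := hx j k hk
      rw [I.piecewise_eq_of_mem _ _ hj] at hxj
      rw [transition_linSystem_sub]
      linarith [min_le_right ρ (η / 2)]
    · obtain ⟨ω', hω'⟩ := hball hdist j hj (x j) (fun k => ω k j) fun k => hω k j hj
      rw [Pi.sub_apply, add_sub_cancel] at hω'
      exact ⟨ω', fun h => absurd h hj, fun k _ => hω' k⟩
  choose ω' hω'I hω' using hcomponent
  refine ⟨fun k j => ω' j k, hω'I, fun k hk => (pi_norm_lt_iff hη).2 fun j => ?_⟩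
  simpa only [Pi.sub_apply, transition_prodSystem] using hω' j k hk

end Network

end Steering

section Entropy

theorem unstableSum_one {d : ℕ} : unstableSum (1 : Matrix (Fin d) (Fin d) ℝ) = 0 := by
  refine Finset.sum_eq_zero fun z hz => ?_
  rw [Matrix.map_one _ (map_zero _) (map_one _), charpoly_one] at hz
  have hroot := (mem_roots'.1 (Multiset.mem_toFinset.1 hz)).2
  rw [IsRoot.def, eval_pow, eval_sub, eval_X, eval_one] at hroot
  simp [sub_eq_zero.1 (eq_zero_of_pow_eq_zero hroot)]

theorem sum_unstableSum_piecewise_one {ι : Type*} [Fintype ι] [DecidableEq ι] {d : ι → ℕ}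
    (A : ∀ j, Matrix (Fin (d j)) (Fin (d j)) ℝ) (I : Finset ι) :
    ∑ j, unstableSum (I.piecewise A 1 j) = ∑ j ∈ I, unstableSum (A j) := by
  rw [← Finset.sum_subset I.subset_univ fun j _ hj => by
    rw [I.piecewise_eq_of_notMem _ _ hj, Pi.one_apply, unstableSum_one]]
  exact Finset.sum_congr rfl fun j hj => by rw [I.piecewise_eq_of_mem _ _ hj]

section Observed

variable {X U β : Type*} [TopologicalSpace X] {f : X → U → X} {π : (ℕ → U) → β} {τ : ℕ} {Q : Set X}

/-- The minimal number of values of the observable `π` whose joint preimage is `(τ, Q)`-spanning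
(`⊤` if there is no finite set of such values). Observing the whole control sequence gives `rInv`,
observing its `i`-th component gives `rSub`. -/
noncomputable def rObs (f : X → U → X) (π : (ℕ → U) → β) (τ : ℕ) (Q : Set X) : ℕ∞ :=
  ⨅ (S : Set β) (_ : IsSpanning f τ Q (π ⁻¹' S)), S.encard

theorem exists_isSpanning_card_eq_rObs (h : rObs f π τ Q ≠ ⊤) :
    ∃ s : Finset β, IsSpanning f τ Q (π ⁻¹' s) ∧ s.card = rObs f π τ Q := by
  rw [rObs, iInf_subtype'] at h ⊢
  have : Nonempty {S : Set β // IsSpanning f τ Q (π ⁻¹' S)} := by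
    by_contra hempty
    rw [not_nonempty_iff] at hempty
    exact h (iInf_of_empty _)
  obtain ⟨⟨S, hS⟩, heq⟩ := ciInf_mem fun S : {S // IsSpanning f τ Q (π ⁻¹' S)} => S.1.encard
  have hfin : S.Finite := Set.encard_ne_top_iff.1 (heq.trans_ne h)
  refine ⟨hfin.toFinset, by simpa using hS, ?_⟩
  rw [← Set.encard_coe_eq_coe_finsetCard, hfin.coe_toFinset]
  exact heq

theorem rObs_le_card {T : Finset (ℕ → U)}
    (hT : ∀ x ∈ Q, ∃ ω₀ ∈ T, ∃ ω, π ω = π ω₀ ∧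
      ∀ k, 1 ≤ k → k ≤ τ → transition f k x ω ∈ interior Q) :
    rObs f π τ Q ≤ T.card := by
  have hspan : IsSpanning f τ Q (π ⁻¹' (π '' T)) := fun x hx => by
    obtain ⟨ω₀, hω₀, ω, hω, htransition⟩ := hT x hx
    exact ⟨ω, ⟨ω₀, hω₀, hω.symm⟩, htransition⟩
  calc rObs f π τ Q ≤ (π '' T).encard := iInf₂_le (π '' T) hspan
    _ ≤ (T : Set (ℕ → U)).encard := Set.encard_image_le _ _
    _ = T.card := Set.encard_coe_eq_coe_finsetCard T

end Observed

section Growth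

variable {ι : Type*} [Finite ι] {d m : ι → ℕ} {A : ∀ j, Matrix (Fin (d j)) (Fin (d j)) ℝ}
  {B : ∀ j, Matrix (Fin (d j)) (Fin (m j)) ℝ} {U : ∀ j, Set (Fin (m j) → ℝ)} {I : Finset ι}
  {Q : Set (∀ j, Fin (d j) → ℝ)}

theorem exists_mul_pow_le_rObs (hQ : IsCompact Q) (hQi : (interior Q).Nonempty) {β : Type*}
    {π : (ℕ → ∀ j, U j) → β} (hπ : ∀ ω ω', π ω = π ω' → ∀ j ∈ I, ∀ k, ω k j = ω' k j) :
    ∃ c : ℝ, 0 < c ∧ ∀ τ, rObs (linNetwork A B U) π τ Q ≠ ⊤ →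
      c * ((2 : ℝ) ^ ∑ j ∈ I, unstableSum (A j)) ^ τ
        ≤ (rObs (linNetwork A B U) π τ Q).toNat := by
  classical
  have := Fintype.ofFinite ι
  have hvol : 0 < volume.real Q :=
    ENNReal.toReal_pos (volume.measure_pos_of_nonempty_interior hQi).ne' hQ.measure_lt_top.ne
  obtain ⟨R, -, hQR⟩ := hQ.isBounded.exists_pos_norm_le
  obtain ⟨c, hc, hcount⟩ := exists_mul_pow_le_card (I.piecewise A 1) hvol (2 * R)
  refine ⟨c, hc, fun τ hτ => ?_⟩
  obtain ⟨s, hs, hcard⟩ := exists_isSpanning_card_eq_rObs hτ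
  rw [← hcard, ENat.toNat_natCast, ← sum_unstableSum_piecewise_one]
  have hdiam : ∀ x ∈ Q, ∀ x' ∈ Q, ‖x - x'‖ ≤ 2 * R := fun x hx x' hx' =>
    (norm_sub_le_of_le (hQR x hx) (hQR x' hx')).trans_eq (two_mul R).symm
  refine hcount τ s (fun b => {x ∈ Q | ∃ ω, π ω = b ∧ transition (linNetwork A B U) τ x ω ∈ Q})
    (fun x hx => ?_) ?_
  · obtain ⟨ω, hω, hspan⟩ := hs x hx
    refine Set.mem_iUnion₂.2 ⟨π ω, hω, hx, ω, rfl, ?_⟩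
    rcases τ.eq_zero_or_pos with rfl | hτ
    exacts [hx, interior_subset (hspan τ hτ le_rfl)]
  · rintro b - x ⟨hx, ω, hω, hend⟩ x' ⟨hx', ω', hω', hend'⟩
    refine ⟨hdiam x hx x' hx', fun j => ?_⟩
    by_cases hj : j ∈ I
    · have hcontrol : (fun k => ω k j) = fun k => ω' k j :=
        funext (hπ ω ω' (hω.trans hω'.symm) j hj)
      rw [I.piecewise_eq_of_mem _ _ hj, ← transition_linSystem_sub (B := B j) τ _ _ fun k => ω k j]
      nth_rewrite 2 [hcontrol]
      rw [← transition_prodSystem fun j => linSystem (A j) (B j) (U j),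
        ← transition_prodSystem fun j => linSystem (A j) (B j) (U j)]
      exact (norm_le_pi_norm (_ - _) j).trans (hdiam _ hend _ hend')
    · rw [I.piecewise_eq_of_notMem _ _ hj, Pi.one_apply, one_pow, one_mulVec]
      exact (norm_le_pi_norm (x - x') j).trans (hdiam x hx x' hx')

theorem exists_shadowing [DecidableEq ι] (hQ : IsControlledInvariant (linNetwork A B U) Q)
    (hAB : ∀ j ∉ I, IsControllable (A j) (B j))
    (hU : ∀ j ∉ I, U j ⊆ closure (interior (U j))) :
    ∃ ρ : ℝ, 0 < ρ ∧ ∀ x ∈ Q, ∃ ω₀ : ℕ → ∀ j, U j, ∀ (τ : ℕ) (x' : ∀ j, Fin (d j) → ℝ),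
      (∀ j, ∀ k ≤ τ, ‖(I.piecewise A 1 j ^ k) *ᵥ (x' j - x j)‖ ≤ ρ) →
      ∃ ω : ℕ → ∀ j, U j, (∀ j ∈ I, ∀ k, ω k j = ω₀ k j) ∧
        ∀ k, 1 ≤ k → k ≤ τ → transition (linNetwork A B U) k x' ω ∈ interior Q := by
  have := Fintype.ofFinite ι
  obtain ⟨η, hη, hmargin⟩ := exists_steering_margin hQ.isCompact isOpen_interior hU hQ.steer
  obtain ⟨ρ, hρ, htrack⟩ := exists_network_tracking (U := U) hAB hη
  refine ⟨ρ, hρ, fun x hx => ?_⟩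
  obtain ⟨ω₀, hω₀⟩ := exists_forall_transition_mem (fun x hx => (hmargin x hx).imp fun _ hu =>
    ⟨interior_subset (hu.1 (Metric.mem_ball_self hη)), hu⟩) hx
  refine ⟨ω₀, fun τ x' hx' => ?_⟩
  obtain ⟨ω, hω, hclose⟩ := htrack x x' ω₀ τ (fun k => (hω₀ k).2.2) hx'
  refine ⟨ω, hω, fun k hk hkτ => ?_⟩
  obtain ⟨l, rfl⟩ := Nat.exists_eq_add_of_le' hk
  exact (hω₀ l).2.1 (mem_ball_iff_norm.2 (hclose _ hkτ))

theorem exists_rObs_le_mul_pow (hQ : IsControlledInvariant (linNetwork A B U) Q)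
    (hAB : ∀ j ∉ I, IsControllable (A j) (B j))
    (hU : ∀ j ∉ I, U j ⊆ closure (interior (U j))) {β : Type*} {π : (ℕ → ∀ j, U j) → β}
    (hπ : ∀ ω ω', (∀ j ∈ I, ∀ k, ω k j = ω' k j) → π ω = π ω') {η : ℝ} (hη : 0 < η) :
    ∃ C : ℝ, 0 < C ∧ ∀ τ, ∃ N : ℕ, rObs (linNetwork A B U) π τ Q ≤ N ∧
      (N : ℝ) ≤ C * ((2 : ℝ) ^ (∑ j ∈ I, unstableSum (A j) + η)) ^ τ := by
  classical
  have := Fintype.ofFinite ι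
  obtain ⟨ρ, hρ, hshadow⟩ := exists_shadowing hQ hAB hU
  obtain ⟨C, hC, hcover⟩ :=
    exists_finset_cover_card_le (I.piecewise A 1) hQ.isCompact.isBounded hρ hη
  rw [sum_unstableSum_piecewise_one] at hcover
  obtain ⟨x₀, hx₀⟩ := hQ.interior_nonempty
  have : Nonempty (ℕ → ∀ j, U j) := (hshadow x₀ (interior_subset hx₀)).nonempty
  choose! ω₀ hω₀ using hshadow
  refine ⟨C, hC, fun τ => ?_⟩
  obtain ⟨t, htQ, hcov, hcard⟩ := hcover τ
  refine ⟨(t.image ω₀).card, rObs_le_card fun x hx => ?_,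
    (Nat.cast_le.2 Finset.card_image_le).trans hcard⟩
  obtain ⟨y, hy, hclose⟩ := hcov x hx
  obtain ⟨ω, hω, htransition⟩ := hω₀ y (htQ hy) τ x hclose
  exact ⟨ω₀ y, Finset.mem_image_of_mem _ hy, ω, hπ _ _ hω, htransition⟩

end Growth

theorem inv_mul_logb_mul_pow {c : ℝ} (hc : 0 < c) (g : ℝ) {τ : ℕ} (hτ : τ ≠ 0) :
    1 / (τ : ℝ) * Real.logb 2 (c * ((2 : ℝ) ^ g) ^ τ) = Real.logb 2 c / τ + g := by
  rw [Real.logb_mul hc.ne' (by positivity), Real.logb_pow, Real.logb_rpow two_pos (by norm_num)]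
  field_simp

theorem tendsto_logb_div_of_exponential_bounds {r : ℕ → ℕ} {h c : ℝ} (hc : 0 < c)
    (hlower : ∀ τ, c * ((2 : ℝ) ^ h) ^ τ ≤ r τ)
    (hupper : ∀ η : ℝ, 0 < η →
      ∃ C : ℝ, 0 < C ∧ ∀ τ, (r τ : ℝ) ≤ C * ((2 : ℝ) ^ (h + η)) ^ τ) :
    Tendsto (fun τ : ℕ => 1 / (τ : ℝ) * Real.logb 2 (r τ)) atTop (𝓝 h) := by
  have hlim : ∀ c g : ℝ, Tendsto (fun τ : ℕ => Real.logb 2 c / (τ : ℝ) + g) atTop (𝓝 g) :=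
    fun c g => by
      simpa using (tendsto_const_div_atTop_nhds_zero_nat (Real.logb 2 c)).add_const g
  refine tendsto_order.2 ⟨fun a ha => ?_, fun a ha => ?_⟩
  · filter_upwards [(hlim c h).eventually_const_lt ha, eventually_ne_atTop 0] with τ hτ hτ0
    rw [← inv_mul_logb_mul_pow hc h hτ0] at hτ
    refine hτ.trans_le (mul_le_mul_of_nonneg_left ?_ (by positivity))
    exact Real.logb_le_logb_of_le one_lt_two (by positivity) (hlower τ)
  · obtain ⟨C, hC, hr⟩ := hupper ((a - h) / 2) (by linarith)
    have hlt : h + (a - h) / 2 < a := by linarith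
    filter_upwards [(hlim C _).eventually_lt_const hlt, eventually_ne_atTop 0] with τ hτ hτ0
    rw [← inv_mul_logb_mul_pow hC _ hτ0] at hτ
    refine (mul_le_mul_of_nonneg_left ?_ (by positivity)).trans_lt hτ
    have hpos : (0 : ℝ) < r τ := lt_of_lt_of_le (by positivity) (hlower τ)
    exact Real.logb_le_logb_of_le one_lt_two hpos (hr τ)

theorem tendsto_logb_rObs {ι : Type*} [Finite ι] {d m : ι → ℕ}
    {A : ∀ j, Matrix (Fin (d j)) (Fin (d j)) ℝ} {B : ∀ j, Matrix (Fin (d j)) (Fin (m j)) ℝ}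
    {U : ∀ j, Set (Fin (m j) → ℝ)} {I : Finset ι} {Q : Set (∀ j, Fin (d j) → ℝ)}
    (hQ : IsControlledInvariant (linNetwork A B U) Q)
    (hAB : ∀ j ∉ I, IsControllable (A j) (B j))
    (hU : ∀ j ∉ I, U j ⊆ closure (interior (U j))) {β : Type*} {π : (ℕ → ∀ j, U j) → β}
    (hπ : ∀ ω ω', π ω = π ω' ↔ ∀ j ∈ I, ∀ k, ω k j = ω' k j) :
    (∀ τ, rObs (linNetwork A B U) π τ Q ≠ ⊤) ∧
      Tendsto (fun τ : ℕ => 1 / (τ : ℝ) * Real.logb 2 (rObs (linNetwork A B U) π τ Q).toNat)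
        atTop (𝓝 (∑ j ∈ I, unstableSum (A j))) := by
  have hupper := fun η hη =>
    exists_rObs_le_mul_pow (η := η) hQ hAB hU (fun ω ω' => (hπ ω ω').2) hη
  have hfin : ∀ τ, rObs (linNetwork A B U) π τ Q ≠ ⊤ := fun τ => by
    obtain ⟨C, -, hC⟩ := hupper 1 one_pos
    obtain ⟨N, hN, -⟩ := hC τ
    exact ne_top_of_le_ne_top (ENat.natCast_ne_top N) hN
  obtain ⟨c, hc, hlower⟩ := exists_mul_pow_le_rObs (A := A) (B := B) hQ.isCompact
    hQ.interior_nonempty fun ω ω' => (hπ ω ω').1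
  refine ⟨hfin, tendsto_logb_div_of_exponential_bounds hc (fun τ => hlower τ (hfin τ))
    fun η hη => ?_⟩
  obtain ⟨C, hC, hbound⟩ := hupper η hη
  refine ⟨C, hC, fun τ => ?_⟩
  obtain ⟨N, hN, hNC⟩ := hbound τ
  exact (Nat.cast_le.2 (ENat.toNat_le_of_le_natCast hN)).trans hNC

end Entropy

end NetEntropy

theorem theorem2_general {ι : Type*} [Fintype ι] (d m : ι → ℕ)
    (A : ∀ j, Matrix (Fin (d j)) (Fin (d j)) ℝ)
    (B : ∀ j, Matrix (Fin (d j)) (Fin (m j)) ℝ)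
    (U : ∀ j, Set (Fin (m j) → ℝ))
    (f : ∀ j, (Fin (d j) → ℝ) → U j → (Fin (d j) → ℝ))
    (hf : ∀ j, f j = NetEntropy.linSystem (A j) (B j) (U j))
    (Q : Set (∀ j, Fin (d j) → ℝ))
    (hQ : NetEntropy.IsControlledInvariant (NetEntropy.prodSystem f) Q) :
    (∀ i,
      (∀ j, j ≠ i → NetEntropy.IsControllable (A j) (B j)) →
      (∀ j, j ≠ i → U j ⊆ closure (interior (U j))) →
        (∀ τ, NetEntropy.rSub f i τ Q ≠ ⊤) ∧
        Tendsto (NetEntropy.subEntropySeq f i Q) atTop (𝓝 (NetEntropy.hSub f i Q)) ∧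
        NetEntropy.hSub f i Q = NetEntropy.unstableSum (A i)) ∧
    (∀ τ, NetEntropy.rInv (NetEntropy.prodSystem f) τ Q ≠ ⊤) ∧
    Tendsto (NetEntropy.entropySeq (NetEntropy.prodSystem f) Q) atTop
      (𝓝 (NetEntropy.hInv (NetEntropy.prodSystem f) Q)) ∧
    NetEntropy.hInv (NetEntropy.prodSystem f) Q = ∑ i, NetEntropy.unstableSum (A i) := by
  obtain rfl : f = fun j => NetEntropy.linSystem (A j) (B j) (U j) := funext hf
  refine ⟨fun i hAB hU => ?_, ?_⟩
  · obtain ⟨hfin, hlim⟩ := NetEntropy.tendsto_logb_rObs (I := {i}) hQ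
      (fun j hj => hAB j (by simpa using hj)) (fun j hj => hU j (by simpa using hj))
      (π := fun ω k => ω k i) fun ω ω' => by simp [funext_iff]
    rw [Finset.sum_singleton] at hlim
    exact ⟨hfin, tendsto_nhds_limUnder ⟨_, hlim⟩, hlim.limUnder_eq⟩
  · obtain ⟨hfin, hlim⟩ := NetEntropy.tendsto_logb_rObs (I := Finset.univ) hQ (by simp) (by simp)
      (π := id) fun ω ω' => by simpa [funext_iff] using forall_comm
    exact ⟨hfin, tendsto_nhds_limUnder ⟨_, hlim⟩, hlim.limUnder_eq⟩

theorem theorem2 {n : ℕ} (d m : Fin n → ℕ)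
    (A : ∀ j, Matrix (Fin (d j)) (Fin (d j)) ℝ)
    (B : ∀ j, Matrix (Fin (d j)) (Fin (m j)) ℝ)
    (U : ∀ j, Set (Fin (m j) → ℝ))
    (f : ∀ j, (Fin (d j) → ℝ) → U j → (Fin (d j) → ℝ))
    (hf : ∀ j, f j = NetEntropy.linSystem (A j) (B j) (U j))
    (Q : Set (∀ j, Fin (d j) → ℝ))
    (hQ : NetEntropy.IsControlledInvariant (NetEntropy.prodSystem f) Q)
    (K : Set (∀ j, Fin (d j) → ℝ)) (hK : IsCompact K) (hKQ : K ⊆ interior Q)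
    (hsteer : ∀ x ∈ Q, ∃ u : ∀ j, U j, NetEntropy.prodSystem f x u ∈ interior K) :
    (∀ i : Fin n,
      (∀ j, j ≠ i → NetEntropy.IsControllable (A j) (B j)) →
      (∀ j, j ≠ i → U j ⊆ closure (interior (U j))) →
        (∀ τ : ℕ, 0 < τ → NetEntropy.rSub f i τ Q ≠ ⊤) ∧
        Tendsto (NetEntropy.subEntropySeq f i Q) atTop (𝓝 (NetEntropy.hSub f i Q)) ∧
        NetEntropy.hSub f i Q = NetEntropy.unstableSum (A i)) ∧
    ((∀ j, NetEntropy.IsControllable (A j) (B j)) →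
      (∀ i j : Fin n, j ≠ i → U j ⊆ closure (interior (U j))) →
        (∀ τ : ℕ, 0 < τ → NetEntropy.rInv (NetEntropy.prodSystem f) τ Q ≠ ⊤) ∧
        Tendsto (NetEntropy.entropySeq (NetEntropy.prodSystem f) Q) atTop
          (𝓝 (NetEntropy.hInv (NetEntropy.prodSystem f) Q)) ∧
        ∑ i, NetEntropy.hSub f i Q = NetEntropy.hInv (NetEntropy.prodSystem f) Q) := by
  obtain ⟨hsub, hfin, hlim, hsum⟩ := theorem2_general d m A B U f hf Q hQ
  exact ⟨fun i hAB hU => (hsub i hAB hU).imp_left fun h τ _ => h τ, fun hAB hU =>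
    ⟨fun τ _ => hfin τ, hlim, hsum ▸ Finset.sum_congr rfl fun i _ =>
      (hsub i (fun j _ => hAB j) (hU i)).2.2⟩⟩
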